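/- **Setting.** Fix $M\in\mathbb N$ and a finite set $\mathcal X$. A *network* is a graph with finite or countably infinite vertex set, without loops or multiple edges, every vertex having at most $M$ neighbours, together with a map from the vertices to $\mathcal X$ (marks). Graphs are either all undirected or all directed; in the directed case distances and random walks follow the directed edges. Networks with one or several distinguished vertices are considered up to isomorphism (bijections of the vertices preserving edges, marks and distinguished vertices). $B_G(o,r)$ is the subnetwork induced on the vertices at distance at most $r$ from $o$, rooted at $o$. For a finite rooted network $H=(H,o')$ let $r(H)\in\mathbb N\cup\{\infty\}$ be the largest distance from $o'$ to a vertex and $F_H=\{(G,o):\exists r\in\mathbb N,\ B_G(o,r)\simeq (H,o')\}$. Let $\mathcal G_*$ be the set of (isomorphism classes of) rooted networks, with the $\sigma$-algebra generated by the sets $F_H$. Let $(F_i)_{i\in\mathbb N}$, $F_i=F_{H_i}$, be an enumeration of all the sets $F_H$, with $r(F_i)=r(H_i)$, and let $(w_i)_{i\in\mathbb N}$ be a summable sequence of positive weights. Let $\mathcal G_\to$ be the set of (isomorphism classes of) networks with a distinguished infinite walk $(G,(o_n)_{n\ge1})$, with the $\sigma$-algebra generated by the events that the $r$-neighbourhood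 of $\{o_1,\dots,o_n\}$ in $G$, with $o_1,\dots,o_n$ distinguished, is isomorphic to a given finite network with $n$ distinguished vertices. For a probability measure $\mu$ on $\mathcal G_*$ let $\mu_\to$ be the law on $\mathcal G_\to$ of $(G,(O_n)_{n\ge1})$, where $(G,o)$ has law $\mu$ and, given $(G,o)$, $(O_n)$ is the simple random walk on $G$ with $O_1=o$ (each step is to a uniformly chosen neighbour; the walk stays put at a vertex that no edge leaves). Call $\mu$ *stationary ergodic* if $\mu_\to$ is invariant and ergodic under the shift $(G,(o_n)_{n\ge1})\mapsto(G,(o_{n+1})_{n\ge1})$. Let $k:\mathbb N\to\mathbb N$ be non-decreasing with $k(n)\to\infty$. The sample $S_n(G,o)$ consists of the vertices $O_1,\dots,O_n$ of the walk and of all vertices at distance at most $k(n)$ from one of them. From it one forms the estimates $$\hat\mu_n(F_i)=\frac1n\sum_{j=1}^n \mathbb I\{(G,O_j)\in F_i\}\ \text{ if } r(F_i)\le k(n),\qquad \hat\mu_n(F_i)=0\ \text{ otherwise,}$$ and the empirical distributional distance $d(S_n(G,o),\mu)=\sum_{i\in\mathbb N} w_i\,|\hat\mu_n(F_i)-\mu(F_i)|$.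 **Proposition.** For any stationary ergodic probability measure $\mu$ on $\mathcal G_*$, $$\lim_{n\to\infty} d(S_n(G,o),\mu)=0\qquad \mu_\to\text{-almost surely},$$ that is, almost surely jointly over the random network $(G,o)\sim\mu$ and the simple random walk on it. -/

import Mathlib

open MeasureTheory ProbabilityTheory Filter Topology
open scoped ENNReal

universe u

namespace RandomNetwork

/-! ### Networks of bounded degree -/

/-- A network: a finite or countably infinite graph without loops or multiple edges, directed or
undirected, in which every vertex has at most `M` neighbours, and whose vertices carry marks
in `X`. -/
structure Network (directed : Prop) (M : ℕ) (X : Type u) where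
  V : Type
  countable_V : Countable V
  Adj : V → V → Prop
  loopless : ∀ v, ¬ Adj v v
  symm : ¬ directed → ∀ v w, Adj v w → Adj w v
  degree_le : ∀ v, {w | Adj v w ∨ Adj w v}.encard ≤ M
  mark : V → X

variable {directed : Prop} {M : ℕ} {X : Type u} {ι κ : Type*}

namespace Network

instance (G : Network directed M X) : Countable G.V := G.countable_V

/-- `G.ReachIn n v w`: there is a path with `n` (directed) edges from `v` to `w`. -/
inductive ReachIn (G : Network directed M X) : ℕ → G.V → G.V → Prop
  | refl (v : G.V) : ReachIn G 0 v v
  | tail {n : ℕ} {v w z : G.V} : ReachIn G n v w → G.Adj w z → ReachIn G (n + 1) v z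

/-- The graph distance from `v` to `w` (along directed edges in the directed case), `⊤` if `w`
cannot be reached from `v`. -/
noncomputable def edist (G : Network directed M X) (v w : G.V) : ℕ∞ :=
  ⨅ n ∈ {n : ℕ | G.ReachIn n v w}, (n : ℕ∞)

/-- The subnetwork induced on a set of vertices. -/
def induce (G : Network directed M X) (S : Set G.V) : Network directed M X where
  V := S
  countable_V := inferInstance
  Adj v w := G.Adj v w
  loopless v := G.loopless v
  symm h v w := G.symm h v w
  degree_le v := by
    refine le_trans ?_ (G.degree_le v)
    rw [← Subtype.val_injective.encard_image]
    refine Set.encard_le_encard ?_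
    rintro _ ⟨w, hw, rfl⟩
    exact hw
  mark v := G.mark v

/-- The possible steps of the simple random walk: to a neighbour (along a directed edge in the
directed case); at a vertex that no edge leaves the walk stays put. -/
def Step (G : Network directed M X) (v w : G.V) : Prop :=
  G.Adj v w ∨ ((∀ z, ¬ G.Adj v z) ∧ w = v)

end Network

/-! ### Isomorphism classes of networks with distinguished vertices -/

/-- A network with distinguished vertices indexed by `ι`: a rooted network if `ι = Unit`, a
network with a finite or infinite sequence of distinguished vertices if `ι = Fin n` or `ι = ℕ`. -/
structure Pointed (directed : Prop) (M : ℕ) (X : Type u) (ι : Type*) where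
  net : Network directed M X
  pt : ι → net.V

namespace Pointed

/-- Isomorphism: a bijection of the vertices that preserves edges, marks, and distinguished
vertices. -/
def Iso (P Q : Pointed directed M X ι) : Prop :=
  ∃ φ : P.net.Adj ≃r Q.net.Adj,
    (∀ v, Q.net.mark (φ v) = P.net.mark v) ∧ ∀ i, φ (P.pt i) = Q.pt i

instance setoid (directed : Prop) (M : ℕ) (X : Type u) (ι : Type*) :
    Setoid (Pointed directed M X ι) where
  r := Iso
  iseqv :=
    { refl := fun P => ⟨RelIso.refl _, fun _ => rfl, fun _ => rfl⟩
      symm := by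
        rintro P Q ⟨φ, hm, hp⟩
        refine ⟨φ.symm, fun v => ?_, fun i => ?_⟩
        · rw [← hm, φ.apply_symm_apply]
        · rw [← hp, φ.symm_apply_apply]
      trans := by
        rintro P Q R ⟨φ, hm, hp⟩ ⟨ψ, hm', hp'⟩
        exact ⟨φ.trans ψ, fun v => by simp [hm, hm'], fun i => by simp [hp, hp']⟩ }

/-- Change of the distinguished vertices: the new one with index `j` is the old one with
index `f j`. -/
def reindex (f : κ → ι) (P : Pointed directed M X ι) : Pointed directed M X κ :=
  ⟨P.net, P.pt ∘ f⟩

/-- The set of vertices at distance at most `r` from one of the distinguished vertices. -/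
def ballSet (r : ℕ) (P : Pointed directed M X ι) : Set P.net.V :=
  {v | ∃ i, P.net.edist (P.pt i) v ≤ r}

lemma _root_.RandomNetwork.Network.edist_le_iff (G : Network directed M X) (v w : G.V) (r : ℕ) :
    G.edist v w ≤ r ↔ ∃ n ≤ r, G.ReachIn n v w := by
  constructor
  · intro h
    by_contra! hcon
    have : ((r + 1 : ℕ) : ℕ∞) ≤ G.edist v w := by
      refine le_iInf₂ fun n hn => ?_
      by_contra hlt
      have : n < r + 1 := by exact_mod_cast not_le.mp hlt
      exact hcon n (by omega) hn
    have := this.trans h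
    norm_cast at this
    omega
  · rintro ⟨n, hn, h⟩
    exact (iInf₂_le n h).trans (by exact_mod_cast hn)

lemma mem_ballSet {r : ℕ} {P : Pointed directed M X ι} {v : P.net.V} :
    v ∈ P.ballSet r ↔ ∃ i, ∃ n ≤ r, P.net.ReachIn n (P.pt i) v := by
  simp only [ballSet, Set.mem_ofPred_eq, Network.edist_le_iff]

lemma pt_mem_ballSet (r : ℕ) (P : Pointed directed M X ι) (i : ι) : P.pt i ∈ P.ballSet r :=
  mem_ballSet.2 ⟨i, 0, Nat.zero_le _, .refl _⟩

/-- The ball of radius `r` around the distinguished vertices, as an induced subnetwork with the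
same distinguished vertices. For a rooted network this is the ball `B_G(o, r)`. -/
def ball (r : ℕ) (P : Pointed directed M X ι) : Pointed directed M X ι :=
  ⟨P.net.induce (P.ballSet r), fun i => ⟨P.pt i, P.pt_mem_ballSet r i⟩⟩

lemma reachIn_map {G H : Network directed M X} (φ : G.Adj ≃r H.Adj) {n : ℕ} {v w : G.V}
    (h : G.ReachIn n v w) : H.ReachIn n (φ v) (φ w) := by
  induction h with
  | refl v => exact .refl _
  | tail _ hadj ih => exact .tail ih (φ.map_rel_iff.2 hadj)

lemma reachIn_map_iff {G H : Network directed M X} (φ : G.Adj ≃r H.Adj) {n : ℕ} {v w : G.V} :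
    H.ReachIn n (φ v) (φ w) ↔ G.ReachIn n v w :=
  ⟨fun h => by simpa using reachIn_map φ.symm h, reachIn_map φ⟩

lemma edist_map {G H : Network directed M X} (φ : G.Adj ≃r H.Adj) (v w : G.V) :
    H.edist (φ v) (φ w) = G.edist v w := by
  simp only [Network.edist, reachIn_map_iff]

lemma step_map_iff {G H : Network directed M X} (φ : G.Adj ≃r H.Adj) {v w : G.V} :
    H.Step (φ v) (φ w) ↔ G.Step v w := by
  simp only [Network.Step, φ.map_rel_iff, φ.injective.eq_iff]
  refine or_congr_right (and_congr_left fun _ => ?_)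
  rw [φ.surjective.forall]
  simp only [φ.map_rel_iff]

lemma Iso.reindex {P Q : Pointed directed M X ι} (h : P ≈ Q) (f : κ → ι) :
    P.reindex f ≈ Q.reindex f := by
  obtain ⟨φ, hm, hp⟩ := h
  exact ⟨φ, hm, fun i => hp (f i)⟩

/-- Criterion for an isomorphism between networks induced on two sets of vertices. -/
lemma induce_iso {G H : Network directed M X} {S : Set G.V} {T : Set H.V} (f : G.V → H.V)
    (hinj : Set.InjOn f S) (himg : f '' S = T)
    (hadj : ∀ v ∈ S, ∀ w ∈ S, H.Adj (f v) (f w) ↔ G.Adj v w)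
    (hmark : ∀ v ∈ S, H.mark (f v) = G.mark v) (p : ι → S) (q : ι → T)
    (hpt : ∀ i, f (p i) = q i) :
    (⟨G.induce S, p⟩ : Pointed directed M X ι) ≈ ⟨H.induce T, q⟩ := by
  subst himg
  refine ⟨⟨Equiv.ofBijective (fun v : S => (⟨f v, v, v.2, rfl⟩ : f '' S)) ⟨?_, ?_⟩, ?_⟩, ?_, ?_⟩
  · rintro ⟨v, hv⟩ ⟨w, hw⟩ h
    exact Subtype.ext (hinj hv hw (congrArg Subtype.val h))
  · rintro ⟨_, v, hv, rfl⟩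
    exact ⟨⟨v, hv⟩, rfl⟩
  · rintro ⟨v, hv⟩ ⟨w, hw⟩
    exact hadj v hv w hw
  · rintro ⟨v, hv⟩
    exact hmark v hv
  · intro i
    exact Subtype.ext (hpt i)

lemma Iso.ball {P Q : Pointed directed M X ι} (h : P ≈ Q) (r : ℕ) : P.ball r ≈ Q.ball r := by
  obtain ⟨φ, hm, hp⟩ := h
  refine induce_iso φ φ.injective.injOn ?_ (fun v _ w _ => φ.map_rel_iff) (fun v _ => hm v) _ _ hp
  ext w
  obtain ⟨v, rfl⟩ := φ.surjective w
  simp only [φ.injective.mem_set_image, ballSet, Set.mem_ofPred_eq, ← hp, edist_map]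

end Pointed

/-- Isomorphism classes of networks with distinguished vertices indexed by `ι`. -/
def PointedClass (directed : Prop) (M : ℕ) (X : Type u) (ι : Type*) :=
  Quotient (Pointed.setoid directed M X ι)

namespace PointedClass

/-- The class of a network with distinguished vertices. -/
def mk (P : Pointed directed M X ι) : PointedClass directed M X ι := Quotient.mk _ P

def reindex (f : κ → ι) : PointedClass directed M X ι → PointedClass directed M X κ :=
  Quotient.map (Pointed.reindex f) fun _ _ h => h.reindex f

def ball (r : ℕ) : PointedClass directed M X ι → PointedClass directed M X ι :=
  Quotient.map (Pointed.ball r) fun _ _ h => h.ball r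

/-- The network has finitely many vertices. -/
def IsFinite : PointedClass directed M X ι → Prop :=
  Quotient.lift (fun P => Finite P.net.V) fun _ _ ⟨φ, _⟩ => propext φ.toEquiv.finite_iff

/-- The set `F_c = {(G, o) : B_G(o, r) ≃ c for some r}`. -/
def cylinder (c : PointedClass directed M X ι) : Set (PointedClass directed M X ι) :=
  {d | ∃ r : ℕ, d.ball r = c}

/-- The σ-algebra generated by the sets `F_c`, over all finite `c`. -/
instance [Finite ι] : MeasurableSpace (PointedClass directed M X ι) :=
  MeasurableSpace.generateFrom {A | ∃ c, IsFinite c ∧ A = cylinder c}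

/-- The distinguished vertices form an infinite walk. -/
def IsWalk : PointedClass directed M X ℕ → Prop :=
  Quotient.lift (fun P => ∀ n, P.net.Step (P.pt n) (P.pt (n + 1))) <| by
    rintro P Q ⟨φ, _, hp⟩
    refine propext (forall_congr' fun n => ?_)
    rw [← hp, ← hp, Pointed.step_map_iff]

end PointedClass

/-- The space `𝒢_*` of rooted networks up to isomorphism. -/
abbrev RootedClass (directed : Prop) (M : ℕ) (X : Type u) := PointedClass directed M X Unit

/-- The radius of a rooted network: the maximal distance from the root to a vertex. -/
noncomputable def RootedClass.radius : RootedClass directed M X → ℕ∞ :=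
  Quotient.lift (fun P => ⨆ v, P.net.edist (P.pt ()) v) <| by
    rintro P Q ⟨φ, _, hp⟩
    rw [← φ.toEquiv.iSup_comp]
    refine iSup_congr fun v => ?_
    rw [← hp]
    exact (Pointed.edist_map φ _ _).symm

/-- The space `𝒢_→` of networks with a distinguished infinite walk, up to isomorphism. -/
def WalkClass (directed : Prop) (M : ℕ) (X : Type u) :=
  {c : PointedClass directed M X ℕ // c.IsWalk}

namespace WalkClass

/-- The network with the first `n + 1` vertices of the walk. -/
def initial (n : ℕ) (x : WalkClass directed M X) : PointedClass directed M X (Fin (n + 1)) :=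
  x.1.reindex (fun i => (i : ℕ))

/-- The network rooted at the `n`-th vertex of the walk; the walk starts at time `0`. -/
def rootAt (n : ℕ) (x : WalkClass directed M X) : RootedClass directed M X :=
  x.1.reindex (fun _ => n)

/-- The σ-algebra generated by finite networks with a distinguished finite walk: by the events
that the `r`-neighbourhood of the first `n + 1` vertices of the walk, together with these vertices,
is isomorphic to a given finite network. -/
instance : MeasurableSpace (WalkClass directed M X) :=
  ⨆ n, MeasurableSpace.comap (initial n) inferInstance

/-- The shift `(G, o₁, o₂, …) ↦ (G, o₂, o₃, …)`. -/
def shift (x : WalkClass directed M X) : WalkClass directed M X :=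
  ⟨x.1.reindex Nat.succ, by
    obtain ⟨c, hc⟩ := x
    induction c using Quotient.inductionOn with
    | _ P => exact fun n => hc (n + 1)⟩

end WalkClass

/-! ### The simple random walk on a network -/

section Walk

instance (G : Network directed M X) : MeasurableSpace G.V := ⊤

instance (G : Network directed M X) : DiscreteMeasurableSpace G.V := ⟨fun _ => trivial⟩

lemma Network.finite_step (G : Network directed M X) (v : G.V) : {w | G.Step v w}.Finite := by
  have h : {w | G.Adj v w ∨ G.Adj w v}.Finite :=
    Set.finite_of_encard_le_coe (G.degree_le v)
  refine (h.union (Set.finite_singleton v)).subset ?_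
  rintro w (hw | ⟨_, rfl⟩)
  · exact Or.inl (Or.inl hw)
  · exact Or.inr rfl

lemma Network.nonempty_step (G : Network directed M X) (v : G.V) : {w | G.Step v w}.Nonempty := by
  by_cases h : ∃ w, G.Adj v w
  · obtain ⟨w, hw⟩ := h
    exact ⟨w, Or.inl hw⟩
  · exact ⟨v, Or.inr ⟨by simpa using h, rfl⟩⟩

/-- One step of the simple random walk: the next vertex is uniformly distributed on the possible
steps. -/
noncomputable def Network.stepKernel (G : Network directed M X) : Kernel G.V G.V where
  toFun v := uniformOn {w | G.Step v w}
  measurable' := Measurable.of_discrete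

instance (G : Network directed M X) : IsMarkovKernel G.stepKernel :=
  ⟨fun v => isProbabilityMeasure_uniformOn (G.finite_step v) (G.nonempty_step v)⟩

/-- The law of the simple random walk on `G` started at `o`. -/
noncomputable def Network.walkLaw (G : Network directed M X) (o : G.V) : Measure (ℕ → G.V) :=
  Kernel.trajMeasure (X := fun _ => G.V) (Measure.dirac o)
    (fun n => G.stepKernel.comap (fun x => x ⟨n, Finset.mem_Iic.2 le_rfl⟩) (by fun_prop))

/-- The trajectories that are walks on `G`. -/
def Network.walks (G : Network directed M X) : Set (ℕ → G.V) :=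
  {w | ∀ n, G.Step (w n) (w (n + 1))}

instance (G : Network directed M X) (o : G.V) : IsProbabilityMeasure (G.walkLaw o) := by
  unfold Network.walkLaw
  infer_instance

open Classical in
/-- The probability that the first `n + 1` positions of the simple random walk started at `o`
are given by `u`. -/
noncomputable def Network.pathProb (G : Network directed M X) (o : G.V) {n : ℕ}
    (u : Fin (n + 1) → G.V) : ℝ≥0∞ :=
  (if u 0 = o then 1 else 0) * ∏ j : Fin n, G.stepKernel (u j.castSucc) {u j.succ}

lemma Network.walkLaw_cylinder (G : Network directed M X) (o : G.V) (n : ℕ)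
    (u : Fin (n + 1) → G.V) :
    G.walkLaw o {w | ∀ j : Fin (n + 1), w j = u j} =
      G.pathProb o u := by
  unfold Network.pathProb
  induction n with
  | zero =>
    have h0 : MeasurableSet {x : (∀ _ : Finset.Iic 0, G.V) | x ⟨0, Finset.mem_Iic.2 le_rfl⟩ = u 0} :=
      (MeasurableSet.of_discrete (s := {u 0})).preimage (measurable_pi_apply _)
    have h1 : {w : ℕ → G.V | ∀ j : Fin (0 + 1), w j = u j} = Preorder.frestrictLe 0 ⁻¹'
        {x : (∀ _ : Finset.Iic 0, G.V) | x ⟨0, Finset.mem_Iic.2 le_rfl⟩ = u 0} := by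
      ext w
      simp [Fin.forall_fin_one]
    have h2 : (G.walkLaw o).map (Preorder.frestrictLe (π := fun _ => G.V) 0) =
        (Measure.dirac o).map (MeasurableEquiv.piUnique (fun _ : Finset.Iic 0 => G.V)).symm := by
      rw [Network.walkLaw, Kernel.trajMeasure, Measure.map_comp _ _ (by fun_prop),
        Kernel.traj_map_frestrictLe, Kernel.partialTraj_self, Measure.id_comp]
    rw [h1, ← Measure.map_apply (by fun_prop) h0, h2, Measure.map_apply (MeasurableEquiv.measurable _) h0,
      Measure.dirac_apply' _ (h0.preimage (MeasurableEquiv.measurable _))]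
    simp only [Fin.prod_univ_zero, mul_one]
    by_cases hu : u 0 = o
    · rw [if_pos hu, Set.indicator_of_mem (by exact hu.symm)]
      rfl
    · rw [if_neg hu, Set.indicator_of_notMem (fun h => hu h.symm)]
  | succ n ih =>
    have h0 : MeasurableSet {x : (∀ _ : Finset.Iic n, G.V) | ∀ j : Fin (n + 1),
        x ⟨j, Finset.mem_Iic.2 (Nat.lt_succ_iff.1 j.2)⟩ = u j.castSucc} := by
      simp only [Set.ofPred_forall]
      exact MeasurableSet.iInter fun j =>
        (MeasurableSet.of_discrete (s := {u j.castSucc})).preimage (measurable_pi_apply _)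
    have h1 : {w : ℕ → G.V | ∀ j : Fin (n + 1 + 1), w j = u j} =
        (fun w => (Preorder.frestrictLe (π := fun _ => G.V) n w, w (n + 1))) ⁻¹'
        ({x : (∀ _ : Finset.Iic n, G.V) | ∀ j : Fin (n + 1),
          x ⟨j, Finset.mem_Iic.2 (Nat.lt_succ_iff.1 j.2)⟩ = u j.castSucc} ×ˢ
            {u (Fin.last (n + 1))}) := by
      ext w
      simp [Fin.forall_fin_succ']
    rw [h1, ← Measure.map_apply (by fun_prop) (h0.prod .of_discrete), Network.walkLaw,
      ← Kernel.map_frestrictLe_trajMeasure_compProd_eq_map_trajMeasure,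
      Measure.compProd_apply_prod h0 .of_discrete]
    rw [setLIntegral_congr_fun (g := fun _ =>
      G.stepKernel (u (Fin.last n).castSucc) {u (Fin.last (n + 1))}) h0]
    · rw [setLIntegral_const, Measure.map_apply (by fun_prop) h0, Fin.prod_univ_castSucc,
        ← mul_assoc, mul_comm]
      refine congrArg₂ _ ?_ rfl
      exact ih (fun j => u j.castSucc)
    · intro x hx
      have := hx (Fin.last n)
      simp only [Fin.val_last] at this
      simp only [Kernel.comap_apply, this]

lemma Network.walkLaw_eq_tsum (G : Network directed M X) (o : G.V) (n : ℕ)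
    (Q : Set (Fin (n + 1) → G.V)) :
    G.walkLaw o {w | (fun j : Fin (n + 1) => w j) ∈ Q} =
      ∑' u : Fin (n + 1) → G.V, Q.indicator (G.pathProb o) u := by
  have hm : Measurable (fun (w : ℕ → G.V) (j : Fin (n + 1)) => w j) := by fun_prop
  have hQ : MeasurableSet Q := Q.to_countable.measurableSet
  rw [show {w : ℕ → G.V | (fun j : Fin (n + 1) => w j) ∈ Q} =
    (fun (w : ℕ → G.V) (j : Fin (n + 1)) => w j) ⁻¹' Q from rfl, ← Measure.map_apply hm hQ,
    ← Measure.tsum_indicator_apply_singleton _ _ hQ]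
  refine tsum_congr fun u => ?_
  refine congrFun (congrArg _ (funext fun u => ?_)) u
  rw [Measure.map_apply hm (measurableSet_singleton _), ← G.walkLaw_cylinder o n u]
  congr 1
  ext w
  simp [funext_iff]

lemma Network.stepKernel_ne_zero {G : Network directed M X} {v w : G.V}
    (h : G.stepKernel v {w} ≠ 0) : G.Step v w := by
  by_contra hs
  refine h ((uniformOn_eq_zero_iff (G.finite_step v)).2 ?_)
  ext z
  simp only [Set.mem_inter_iff, Set.mem_ofPred_eq, Set.mem_singleton_iff, Set.mem_empty_iff_false,
    iff_false, not_and]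
  rintro hz rfl
  exact hs hz

/-- The law of the first `n` steps only depends on the possible steps at the vertices within
distance `n` of the starting point. -/
lemma Network.walkLaw_congr {G H : Network directed M X} (f : H.V → G.V) (hf : f.Injective)
    (o : H.V) (n : ℕ)
    (hstep : ∀ v, ∀ m ≤ n, H.ReachIn m o v → {w | G.Step (f v) w} = f '' {w | H.Step v w})
    (Q : Set (Fin (n + 1) → H.V)) (R : Set (Fin (n + 1) → G.V))
    (hQR : ∀ u : Fin (n + 1) → H.V,
      (∀ j : Fin (n + 1), ∃ m ≤ (j : ℕ), H.ReachIn m o (u j)) → (u ∈ Q ↔ f ∘ u ∈ R)) :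
    H.walkLaw o {w | (fun j : Fin (n + 1) => w j) ∈ Q} =
      G.walkLaw (f o) {w | (fun j : Fin (n + 1) => w j) ∈ R} := by
  classical
  have hker : ∀ v, ∀ m ≤ n, H.ReachIn m o v → ∀ w,
      G.stepKernel (f v) {f w} = H.stepKernel v {w} := by
    intro v m hm hv w
    change uniformOn {w | G.Step (f v) w} {f w} = uniformOn {w | H.Step v w} {w}
    rw [hstep v m hm hv, uniformOn, uniformOn, cond_apply .of_discrete, cond_apply .of_discrete,
      ← Set.image_singleton, ← Set.image_inter hf, Measure.count_injective_image hf,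
      Measure.count_injective_image hf]
  have hreach : ∀ {m : ℕ} {v w : H.V}, H.ReachIn m o v → H.Step v w →
      ∃ m' ≤ m + 1, H.ReachIn m' o w := by
    rintro m v w h (hvw | ⟨_, rfl⟩)
    · exact ⟨_, le_rfl, h.tail hvw⟩
    · exact ⟨m, by omega, h⟩
  rw [walkLaw_eq_tsum, walkLaw_eq_tsum]
  have hinj : Function.Injective (fun u : Fin (n + 1) → H.V => f ∘ u) := hf.comp_left
  rw [← hinj.tsum_eq]
  · refine tsum_congr fun u => ?_
    by_cases hu : ∀ j : Fin (n + 1), ∃ m ≤ (j : ℕ), H.ReachIn m o (u j)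
    · have e : G.pathProb (f o) (f ∘ u) =
          H.pathProb o u := by
        unfold pathProb
        congr 1
        · by_cases h0 : u 0 = o
          · rw [if_pos h0, if_pos (show (f ∘ u) 0 = f o from congrArg f h0)]
          · rw [if_neg h0, if_neg (show ¬ (f ∘ u) 0 = f o from fun h => h0 (hf h))]
        · refine Finset.prod_congr rfl fun j _ => ?_
          obtain ⟨m, hm, hr⟩ := hu j.castSucc
          exact hker _ m (by simp at hm; omega) hr _
      simp only [Set.indicator_apply, hQR u hu] at e ⊢
      rw [e]
    · have e1 : H.pathProb o u = 0 := by
        by_contra hne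
        rw [pathProb, mul_eq_zero, not_or, Finset.prod_eq_zero_iff] at hne
        obtain ⟨h1, h2⟩ := hne
        push Not at h2
        refine hu fun j => ?_
        induction j using Fin.induction with
        | zero =>
          have : u 0 = o := by
            by_contra hno
            exact h1 (if_neg hno)
          exact ⟨0, le_rfl, this ▸ .refl _⟩
        | succ j ih =>
          obtain ⟨m, hm, hr⟩ := ih
          obtain ⟨m', hm', hr'⟩ := hreach hr (stepKernel_ne_zero (h2 j (Finset.mem_univ _)))
          exact ⟨m', by simp at hm ⊢; omega, hr'⟩
      have e2 : G.pathProb (f o) (f ∘ u) = 0 := by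
        by_contra hne
        rw [pathProb, mul_eq_zero, not_or, Finset.prod_eq_zero_iff] at hne
        obtain ⟨h1, h2⟩ := hne
        push Not at h2
        refine hu fun j => ?_
        induction j using Fin.induction with
        | zero =>
          have : f (u 0) = f o := by
            by_contra hno
            exact h1 (if_neg hno)
          exact ⟨0, le_rfl, hf this ▸ .refl _⟩
        | succ j ih =>
          obtain ⟨m, hm, hr⟩ := ih
          have hs : (f ∘ u) j.succ ∈ {w | G.Step (f (u j.castSucc)) w} :=
            stepKernel_ne_zero (h2 j (Finset.mem_univ _))
          rw [hstep _ m (by simp at hm; omega) hr] at hs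
          obtain ⟨z, hz, hzu⟩ := hs
          rw [hf hzu] at hz
          obtain ⟨m', hm', hr'⟩ := hreach hr hz
          exact ⟨m', by simp at hm ⊢; omega, hr'⟩
      simp only [Set.indicator_apply] at e1 e2 ⊢
      rw [e1, e2]
      simp
  · intro u hu
    have hne : G.pathProb (f o) u ≠ 0 := by
      intro h0
      refine hu ?_
      simp only [Set.indicator_apply] at h0 ⊢
      rw [h0, ite_self]
    rw [pathProb, mul_ne_zero_iff, Finset.prod_ne_zero_iff] at hne
    obtain ⟨h1, h2⟩ := hne
    have key : ∀ j : Fin (n + 1), ∃ v, u j = f v ∧ ∃ m ≤ (j : ℕ), H.ReachIn m o v := by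
      intro j
      induction j using Fin.induction with
      | zero =>
        have : u 0 = f o := by
          by_contra hno
          exact h1 (if_neg hno)
        exact ⟨o, this, 0, le_rfl, .refl _⟩
      | succ j ih =>
        obtain ⟨v, huv, m, hm, hr⟩ := ih
        have hs : u j.succ ∈ {w | G.Step (u j.castSucc) w} :=
          stepKernel_ne_zero (h2 j (Finset.mem_univ _))
        rw [huv, hstep _ m (by simp at hm; omega) hr] at hs
        obtain ⟨z, hz, hzu⟩ := hs
        obtain ⟨m', hm', hr'⟩ := hreach hr hz
        exact ⟨z, hzu.symm, m', by simp at hm ⊢; omega, hr'⟩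
    choose v hv _ using key
    exact ⟨v, funext fun j => (hv j).symm⟩

lemma Network.measurableSet_walks (G : Network directed M X) : MeasurableSet G.walks := by
  simp only [walks, Set.ofPred_forall]
  refine MeasurableSet.iInter fun n => ?_
  have : MeasurableSet {p : G.V × G.V | G.Step p.1 p.2} := (Set.to_countable _).measurableSet
  exact this.preimage (f := fun w : ℕ → G.V => (w n, w (n + 1))) (by fun_prop)

lemma Network.ae_mem_walks (G : Network directed M X) (o : G.V) :
    ∀ᵐ w ∂G.walkLaw o, w ∈ G.walks := by
  refine ae_all_iff.2 fun n => ?_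
  have := G.walkLaw_eq_tsum o (n + 1) {u | ¬ G.Step (u (Fin.last n).castSucc) (u (Fin.last n).succ)}
  rw [ENNReal.tsum_eq_zero.2] at this
  · exact this
  · intro u
    rw [Set.indicator_apply_eq_zero]
    intro hu
    rw [pathProb, mul_eq_zero]
    refine Or.inr (Finset.prod_eq_zero (Finset.mem_univ (Fin.last n)) ?_)
    by_contra hne
    exact hu (stepKernel_ne_zero hne)

/-- The class in `𝒢_→` of `G` with a given walk. -/
def Network.toWalkClass (G : Network directed M X) (w : G.walks) : WalkClass directed M X :=
  ⟨PointedClass.mk ⟨G, w.1⟩, w.2⟩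

end Walk

/-! ### Measurability of the law of the simple random walk -/

namespace Pointed

lemma reachIn_trans {G : Network directed M X} {m n : ℕ} {v w z : G.V} (h : G.ReachIn m v w)
    (h' : G.ReachIn n w z) : G.ReachIn (m + n) v z := by
  induction h' with
  | refl => exact h
  | tail _ hadj ih => exact (ih h).tail hadj

lemma reachIn_of_induce {G : Network directed M X} {S : Set G.V} {n : ℕ} {v w : S}
    (h : (G.induce S).ReachIn n v w) : G.ReachIn n v w := by
  have key : ∀ {H : Network directed M X} (f : H.V → G.V) (_ : ∀ v w, H.Adj v w → G.Adj (f v) (f w))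
      {m : ℕ} {v w : H.V}, H.ReachIn m v w → G.ReachIn m (f v) (f w) := by
    intro H f hf m v w h
    induction h with
    | refl v => exact .refl _
    | tail _ hadj ih => exact .tail ih (hf _ _ hadj)
  exact key (H := G.induce S) Subtype.val (fun _ _ h => h) h

lemma reachIn_induce {G : Network directed M X} {S : Set G.V} {r n : ℕ} {v w : G.V}
    (h : G.ReachIn n v w) (hr : n ≤ r) (hS : ∀ m ≤ r, ∀ z, G.ReachIn m v z → z ∈ S)
    (hv : v ∈ S) (hw : w ∈ S) : (G.induce S).ReachIn n ⟨v, hv⟩ ⟨w, hw⟩ := by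
  induction h with
  | refl v => exact .refl _
  | @tail n v w z h hadj ih =>
    have hw' : w ∈ S := hS n (by omega) w h
    exact Network.ReachIn.tail (G := G.induce S) (w := (⟨w, hw'⟩ : S)) (ih (by omega) hS hv hw') hadj

lemma ball_induce (G : Network directed M X) (S : Set G.V) (p : ι → S) (r : ℕ)
    (hS : ∀ i, ∀ m ≤ r, ∀ z, G.ReachIn m (p i) z → z ∈ S) :
    (⟨G.induce S, p⟩ : Pointed directed M X ι).ball r ≈
      (⟨G, fun i => p i⟩ : Pointed directed M X ι).ball r := by
  refine induce_iso (G := G.induce S) (H := G) Subtype.val Subtype.val_injective.injOn ?_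
    (fun _ _ _ _ => Iff.rfl) (fun _ _ => rfl) _ _ (fun _ => rfl)
  ext v
  constructor
  · rintro ⟨w, hw, rfl⟩
    obtain ⟨i, n, hn, h⟩ := mem_ballSet.1 hw
    exact mem_ballSet.2 ⟨i, n, hn, reachIn_of_induce h⟩
  · intro hv
    obtain ⟨i, n, hn, h⟩ := mem_ballSet.1 hv
    exact ⟨⟨v, hS i n hn v h⟩,
      mem_ballSet.2 ⟨i, n, hn, reachIn_induce h hn (hS i) (p i).2 (hS i n hn v h)⟩, rfl⟩

lemma ballSet_mono (P : Pointed directed M X ι) {r R : ℕ} (h : r ≤ R) :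
    P.ballSet r ⊆ P.ballSet R := by
  intro v hv
  obtain ⟨i, n, hn, hr⟩ := mem_ballSet.1 hv
  exact mem_ballSet.2 ⟨i, n, hn.trans h, hr⟩

lemma ball_reindex_ball (P : Pointed directed M X ι) (f : κ → ι) {r R : ℕ} (h : r ≤ R) :
    ((P.ball R).reindex f).ball r ≈ (P.reindex f).ball r :=
  ball_induce P.net (P.ballSet R) (fun j => ⟨P.pt (f j), P.pt_mem_ballSet R _⟩) r
    fun j m hm _ hz => mem_ballSet.2 ⟨f j, m, hm.trans h, hz⟩

lemma ball_ball_of_le (P : Pointed directed M X ι) {r R : ℕ} (h : r ≤ R) :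
    (P.ball r).ball R ≈ P.ball r := by
  refine induce_iso (G := (P.ball r).net) (H := P.net) Subtype.val Subtype.val_injective.injOn ?_
    (fun _ _ _ _ => Iff.rfl) (fun _ _ => rfl) _ _ (fun _ => rfl)
  ext v
  constructor
  · rintro ⟨w, hw, rfl⟩
    exact w.2
  · intro hv
    refine ⟨⟨v, hv⟩, ?_, rfl⟩
    obtain ⟨i, n, hn, hr⟩ := mem_ballSet.1 hv
    exact mem_ballSet.2 ⟨i, n, hn.trans h, reachIn_induce hr hn
      (fun m hm z hz => mem_ballSet.2 ⟨i, m, hm, hz⟩) (P.pt_mem_ballSet r i) hv⟩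

lemma finite_ballSet [Finite ι] (P : Pointed directed M X ι) (r : ℕ) : (P.ballSet r).Finite := by
  have key : ∀ n v, {w | P.net.ReachIn n v w}.Finite := by
    intro n
    induction n with
    | zero =>
      intro v
      refine (Set.finite_singleton v).subset ?_
      rintro w ⟨⟩
      rfl
    | succ n ih =>
      intro v
      refine ((ih v).biUnion fun w _ => P.net.finite_step w).subset ?_
      rintro z (_ | ⟨h, hadj⟩)
      exact Set.mem_biUnion h (Or.inl hadj)
  refine (Set.finite_iUnion fun i : ι => (Set.finite_Iic r).biUnion fun n _ =>
    key n (P.pt i)).subset ?_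
  intro v hv
  obtain ⟨i, n, hn, hr⟩ := mem_ballSet.1 hv
  exact Set.mem_iUnion.2 ⟨i, Set.mem_biUnion hn hr⟩

end Pointed

namespace PointedClass

lemma ball_reindex_ball (c : PointedClass directed M X ι) (f : κ → ι) {r R : ℕ} (h : r ≤ R) :
    ((c.ball R).reindex f).ball r = (c.reindex f).ball r := by
  induction c using Quotient.inductionOn with
  | _ P => exact Quotient.sound (P.ball_reindex_ball f h)

lemma reindex_reindex {μ : Type*} (c : PointedClass directed M X ι) (f : κ → ι) (g : μ → κ) :
    (c.reindex f).reindex g = c.reindex (f ∘ g) := by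
  induction c using Quotient.inductionOn with
  | _ P => rfl

lemma reindex_id (c : PointedClass directed M X ι) : c.reindex id = c := by
  induction c using Quotient.inductionOn with
  | _ P => rfl

lemma ball_ball (c : PointedClass directed M X ι) (r R : ℕ) :
    (c.ball r).ball R = c.ball (min r R) := by
  rcases le_total r R with h | h
  · rw [min_eq_left h]
    induction c using Quotient.inductionOn with
    | _ P => exact Quotient.sound (P.ball_ball_of_le h)
  · rw [min_eq_right h]
    simpa only [reindex_id] using c.ball_reindex_ball id h

lemma isFinite_ball [Finite ι] (c : PointedClass directed M X ι) (r : ℕ) :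
    (c.ball r).IsFinite := by
  induction c using Quotient.inductionOn with
  | _ P => exact (P.finite_ballSet r)

/-- The number of vertices, `0` if infinite. -/
noncomputable def card : PointedClass directed M X ι → ℕ :=
  Quotient.lift (fun P => Nat.card P.net.V) fun _ _ ⟨φ, _⟩ => Nat.card_congr φ.toEquiv

lemma card_ball_mono [Finite ι] (c : PointedClass directed M X ι) {r R : ℕ} (h : r ≤ R) :
    (c.ball r).card ≤ (c.ball R).card := by
  induction c using Quotient.inductionOn with
  | _ P => exact Set.ncard_le_ncard (P.ballSet_mono h) (P.finite_ballSet R)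

lemma ball_eq_of_card_le [Finite ι] (c : PointedClass directed M X ι) {r R : ℕ} (h : r ≤ R)
    (hc : (c.ball R).card ≤ (c.ball r).card) : c.ball r = c.ball R := by
  induction c using Quotient.inductionOn with
  | _ P =>
    have : P.ballSet r = P.ballSet R :=
      Set.eq_of_subset_of_ncard_le (P.ballSet_mono h) hc (P.finite_ballSet R)
    refine Quotient.sound (Pointed.induce_iso id (Set.injOn_id _) ?_ (fun _ _ _ _ => Iff.rfl)
      (fun _ _ => rfl) _ _ (fun _ => rfl))
    rw [Set.image_id, this]

lemma countable_isFinite [Finite ι] [Finite X] :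
    {c : PointedClass directed M X ι | c.IsFinite}.Countable := by
  let D := Σ n : ℕ, (Fin n → Fin n → Prop) × (Fin n → X) × (ι → Fin n)
  let A : D → Set (PointedClass directed M X ι) := fun d => {c | ∃ P, mk P = c ∧
    ∃ e : P.net.V ≃ Fin d.1, (∀ v w, P.net.Adj v w ↔ d.2.1 (e v) (e w)) ∧
      (∀ v, P.net.mark v = d.2.2.1 (e v)) ∧ ∀ i, e (P.pt i) = d.2.2.2 i}
  have hA : (⋃ d, A d).Countable := by
    refine Set.countable_iUnion fun d => Set.Subsingleton.countable ?_
    rintro _ ⟨P, rfl, e, h1, h2, h3⟩ _ ⟨Q, rfl, e', h1', h2', h3'⟩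
    refine Quotient.sound ⟨⟨e.trans e'.symm, ?_⟩, ?_, ?_⟩
    · intro v w
      simp [h1, h1']
    · intro v
      simp [h2, h2']
    · intro i
      simp [h3, ← h3']
  refine hA.mono fun c hc => ?_
  induction c using Quotient.inductionOn with
  | _ P =>
    have : Finite P.net.V := hc
    let e := Finite.equivFin P.net.V
    exact Set.mem_iUnion.2 ⟨⟨_, fun v w => P.net.Adj (e.symm v) (e.symm w),
      fun v => P.net.mark (e.symm v), fun i => e (P.pt i)⟩, P, rfl, e, by simp, by simp, by simp⟩

lemma measurableSet_cylinder [Finite ι] {c : PointedClass directed M X ι} (hc : c.IsFinite) :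
    MeasurableSet c.cylinder :=
  MeasurableSpace.measurableSet_generateFrom ⟨c, hc, rfl⟩

lemma measurableSet_ball_mem [Finite ι] [Finite X] (R : ℕ)
    (T : Set (PointedClass directed M X ι)) :
    MeasurableSet {c : PointedClass directed M X ι | c.ball R ∈ T} := by
  have key : ∀ g : PointedClass directed M X ι, g.IsFinite →
      MeasurableSet {c : PointedClass directed M X ι | c.ball R = g} := by
    intro g hg
    by_cases hR : g.ball R = g
    · have : {c : PointedClass directed M X ι | c.ball R = g} = g.cylinder ∩
          ⋂ g' ∈ {g' : PointedClass directed M X ι |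
            g'.IsFinite ∧ g'.ball R = g' ∧ g.card < g'.card}, g'.cylinderᶜ := by
        ext c
        simp only [Set.mem_ofPred_eq, Set.mem_inter_iff, Set.mem_iInter, Set.mem_compl_iff]
        constructor
        · rintro rfl
          refine ⟨⟨R, rfl⟩, ?_⟩
          rintro g' ⟨_, hg', hlt⟩ ⟨r, rfl⟩
          rw [ball_ball] at hg'
          rw [← hg'] at hlt
          exact absurd (c.card_ball_mono (min_le_right r R)) (not_le.2 hlt)
        · rintro ⟨⟨r, rfl⟩, h⟩
          rw [ball_ball] at hR
          rw [← hR]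
          refine (c.ball_eq_of_card_le (min_le_right r R) ?_).symm
          by_contra hlt
          rw [not_le, hR] at hlt
          exact h _ ⟨c.isFinite_ball R, by rw [ball_ball, min_self], hlt⟩ ⟨R, rfl⟩
      rw [this]
      exact (measurableSet_cylinder hg).inter (MeasurableSet.biInter
        (countable_isFinite.mono fun _ h => h.1) fun g' h => (measurableSet_cylinder h.1).compl)
    · convert MeasurableSet.empty
      ext c
      simp only [Set.mem_ofPred_eq, Set.mem_empty_iff_false, iff_false]
      rintro rfl
      exact hR (by rw [ball_ball, min_self])
  have : {c : PointedClass directed M X ι | c.ball R ∈ T} =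
      ⋃ g ∈ T ∩ {g | g.IsFinite}, {c | c.ball R = g} := by
    ext c
    simp only [Set.mem_ofPred_eq, Set.mem_iUnion, exists_prop]
    exact ⟨fun h => ⟨_, ⟨h, c.isFinite_ball R⟩, rfl⟩, fun ⟨g, h, hg⟩ => hg ▸ h.1⟩
  rw [this]
  exact MeasurableSet.biUnion (countable_isFinite.mono Set.inter_subset_right)
    fun g h => key g h.2

end PointedClass

namespace WalkClass

lemma measurable_initial (n : ℕ) :
    Measurable (initial n : WalkClass directed M X → _) :=
  measurable_iff_comap_le.2 (le_iSup (fun n => MeasurableSpace.comap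
    (initial n : WalkClass directed M X → _) inferInstance) n)

/-- The events that depend on the `n`-neighbourhood of the first `n + 1` vertices of the walk. -/
def localEvent (n : ℕ) (T : Set (PointedClass directed M X (Fin (n + 1)))) :
    Set (WalkClass directed M X) := {x | (x.initial n).ball n ∈ T}

lemma exists_localEvent {n r k : ℕ} (hn : n ≤ k) (hr : r ≤ k)
    (T : Set (PointedClass directed M X (Fin (n + 1)))) :
    ∃ T', {x : WalkClass directed M X | (x.initial n).ball r ∈ T} = localEvent k T' := by
  have hc : n + 1 ≤ k + 1 := by omega
  refine ⟨{d | (d.reindex (Fin.castLE hc)).ball r ∈ T}, ?_⟩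
  ext x
  simp only [localEvent, Set.mem_ofPred_eq]
  rw [PointedClass.ball_reindex_ball _ _ hr, initial, initial, PointedClass.reindex_reindex]
  rfl

lemma isPiSystem_localEvent :
    IsPiSystem {A : Set (WalkClass directed M X) | ∃ n T, A = localEvent n T} := by
  rintro _ ⟨n, T, rfl⟩ _ ⟨m, T', rfl⟩ _
  obtain ⟨U, hU⟩ := exists_localEvent (le_max_left n m) (le_max_left n m) T
  obtain ⟨U', hU'⟩ := exists_localEvent (le_max_right n m) (le_max_right n m) T'
  refine ⟨max n m, U ∩ U', ?_⟩
  rw [localEvent, localEvent, hU, hU']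
  rfl

lemma generateFrom_localEvent [Finite X] :
    (inferInstance : MeasurableSpace (WalkClass directed M X)) =
      MeasurableSpace.generateFrom {A | ∃ n T, A = localEvent n T} := by
  refine le_antisymm (iSup_le fun n => ?_) (MeasurableSpace.generateFrom_le ?_)
  · refine (MeasurableSpace.comap_generateFrom).trans_le (MeasurableSpace.generateFrom_le ?_)
    rintro _ ⟨_, ⟨g, _, rfl⟩, rfl⟩
    have : initial n ⁻¹' g.cylinder =
        ⋃ r, {x : WalkClass directed M X | (x.initial n).ball r ∈ ({g} : Set _)} := by
      ext x
      simp [PointedClass.cylinder]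
    rw [this]
    refine MeasurableSet.iUnion fun r => ?_
    obtain ⟨U, hU⟩ := exists_localEvent (le_max_left n r) (le_max_right n r)
      ({g} : Set (PointedClass directed M X (Fin (n + 1))))
    rw [hU]
    exact MeasurableSpace.measurableSet_generateFrom ⟨_, _, rfl⟩
  · rintro _ ⟨n, T, rfl⟩
    exact (PointedClass.measurableSet_ball_mem n T).preimage (measurable_initial n)

end WalkClass

lemma Network.measurable_toWalkClass (G : Network directed M X) : Measurable G.toWalkClass := by
  refine measurable_iff_comap_le.2 ?_
  change MeasurableSpace.comap G.toWalkClass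
    (⨆ n, MeasurableSpace.comap (WalkClass.initial n) inferInstance) ≤ _
  rw [MeasurableSpace.comap_iSup]
  refine iSup_le fun n => ?_
  rw [MeasurableSpace.comap_comp, ← measurable_iff_comap_le]
  have h : Measurable (fun (u : Fin (n + 1) → G.V) => PointedClass.mk ⟨G, u⟩) :=
    fun s _ => (Set.to_countable _).measurableSet
  exact h.comp (g := fun (u : Fin (n + 1) → G.V) => PointedClass.mk ⟨G, u⟩)
    (f := fun (w : G.walks) (j : Fin (n + 1)) => w.1 j)
    (measurable_pi_iff.2 fun j => (measurable_pi_apply _).comp measurable_subtype_coe)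

/-- The law on `𝒢_→` of a rooted network together with the simple random walk started at its
root. -/
noncomputable def Pointed.walkMeasure (P : Pointed directed M X Unit) :
    Measure (WalkClass directed M X) :=
  ((P.net.walkLaw (P.pt ())).comap Subtype.val).map P.net.toWalkClass

lemma Pointed.walkMeasure_apply (P : Pointed directed M X Unit) {A : Set (WalkClass directed M X)}
    (hA : MeasurableSet A) {B : Set (ℕ → P.net.V)} (hAB : ∀ w, P.net.toWalkClass w ∈ A ↔ w.1 ∈ B) :
    P.walkMeasure A = P.net.walkLaw (P.pt ()) B := by
  have hemb : MeasurableEmbedding (Subtype.val : P.net.walks → _) :=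
    MeasurableEmbedding.subtype_coe P.net.measurableSet_walks
  rw [walkMeasure, Measure.map_apply P.net.measurable_toWalkClass hA, hemb.comap_apply,
    show P.net.toWalkClass ⁻¹' A = Subtype.val ⁻¹' B from Set.ext hAB, Subtype.image_preimage_coe]
  refine measure_congr ?_
  filter_upwards [P.net.ae_mem_walks (P.pt ())] with w hw
  exact propext ⟨fun h => h.2, fun h => ⟨hw, h⟩⟩

instance (P : Pointed directed M X Unit) : IsProbabilityMeasure P.walkMeasure :=
  ⟨by rw [P.walkMeasure_apply MeasurableSet.univ (B := Set.univ) (by simp), measure_univ]⟩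

lemma Pointed.walkMeasure_localEvent [Finite X] (P : Pointed directed M X Unit) (n : ℕ)
    (T : Set (PointedClass directed M X (Fin (n + 1)))) :
    P.walkMeasure (WalkClass.localEvent n T) = P.net.walkLaw (P.pt ())
      {w | (fun j : Fin (n + 1) => w j) ∈
        {u : Fin (n + 1) → P.net.V | (PointedClass.mk ⟨P.net, u⟩).ball n ∈ T}} :=
  P.walkMeasure_apply ((PointedClass.measurableSet_ball_mem n T).preimage
    (WalkClass.measurable_initial n)) fun _ => Iff.rfl

lemma Pointed.walkMeasure_congr [Finite X] {P Q : Pointed directed M X Unit} (h : P ≈ Q) :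
    P.walkMeasure = Q.walkMeasure := by
  refine ext_of_generate_finite _ WalkClass.generateFrom_localEvent
    WalkClass.isPiSystem_localEvent ?_ (by simp)
  rintro _ ⟨n, T, rfl⟩
  obtain ⟨φ, hm, hp⟩ := h
  rw [walkMeasure_localEvent, walkMeasure_localEvent, ← hp]
  refine Network.walkLaw_congr φ φ.injective _ n ?_ _ _ ?_
  · intro v _ _ _
    ext w
    obtain ⟨w, rfl⟩ := φ.surjective w
    simp [step_map_iff, φ.injective.mem_set_image]
  · intro u _
    have : PointedClass.mk ⟨P.net, u⟩ = PointedClass.mk ⟨Q.net, φ ∘ u⟩ :=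
      Quotient.sound ⟨φ, hm, fun _ => rfl⟩
    simp [this]

lemma Pointed.walkMeasure_ball [Finite X] (P : Pointed directed M X Unit) (n : ℕ)
    (T : Set (PointedClass directed M X (Fin (n + 1)))) :
    (P.ball (2 * n + 1)).walkMeasure (WalkClass.localEvent n T) =
      P.walkMeasure (WalkClass.localEvent n T) := by
  rw [walkMeasure_localEvent, walkMeasure_localEvent]
  refine Network.walkLaw_congr (G := P.net) (H := (P.ball (2 * n + 1)).net)
    Subtype.val Subtype.val_injective _ n ?_ _ _ ?_
  · intro v m hm hv
    have hv' : P.net.ReachIn m (P.pt ()) v.1 := reachIn_of_induce hv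
    have hmem : ∀ z, P.net.Adj v.1 z → z ∈ P.ballSet (2 * n + 1) := fun z hz =>
      mem_ballSet.2 ⟨(), m + 1, by omega, hv'.tail hz⟩
    ext w
    constructor
    · rintro (hw | ⟨h, rfl⟩)
      · exact ⟨⟨w, hmem w hw⟩, Or.inl hw, rfl⟩
      · exact ⟨v, Or.inr ⟨fun z hz => h z.1 hz, rfl⟩, rfl⟩
    · rintro ⟨w, hw | ⟨h, rfl⟩, rfl⟩
      · exact Or.inl hw
      · exact Or.inr ⟨fun z hz => h ⟨z, hmem z hz⟩ hz, rfl⟩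
  · intro u hu
    have : (PointedClass.mk ⟨(P.ball (2 * n + 1)).net, u⟩).ball n =
        (PointedClass.mk ⟨P.net, Subtype.val ∘ u⟩).ball n := by
      refine Quotient.sound (ball_induce P.net (P.ballSet (2 * n + 1)) u n ?_)
      intro j m hm z hz
      obtain ⟨m', hm', h⟩ := hu j
      exact mem_ballSet.2 ⟨(), m' + m, by omega, reachIn_trans (reachIn_of_induce h) hz⟩
    change _ ∈ T ↔ _ ∈ T
    rw [this]
    rfl

/-- The kernel that maps a rooted network to the law on `𝒢_→` of this network together with the
simple random walk started at the root. -/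
noncomputable def walkKernel (directed : Prop) (M : ℕ) (X : Type u) [Finite X] :
    Kernel (RootedClass directed M X) (WalkClass directed M X) where
  toFun := Quotient.lift Pointed.walkMeasure fun _ _ h => Pointed.walkMeasure_congr h
  measurable' := by
    have : ∀ c : RootedClass directed M X, IsProbabilityMeasure
        (Quotient.lift Pointed.walkMeasure (fun _ _ h => Pointed.walkMeasure_congr h) c) := by
      intro c
      induction c using Quotient.inductionOn with
      | _ P => exact inferInstanceAs (IsProbabilityMeasure P.walkMeasure)
    refine Measurable.measure_of_isPiSystem_of_isProbabilityMeasure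
      WalkClass.generateFrom_localEvent WalkClass.isPiSystem_localEvent ?_
    rintro _ ⟨n, T, rfl⟩
    intro s _
    convert PointedClass.measurableSet_ball_mem (2 * n + 1) ((fun c : RootedClass directed M X =>
      Quotient.lift Pointed.walkMeasure (fun _ _ h => Pointed.walkMeasure_congr h) c
        (WalkClass.localEvent n T)) ⁻¹' s) using 1
    ext c
    induction c using Quotient.inductionOn with
    | _ P =>
      change P.walkMeasure _ ∈ s ↔ (P.ball (2 * n + 1)).walkMeasure _ ∈ s
      rw [P.walkMeasure_ball]

instance [Finite X] : IsMarkovKernel (walkKernel directed M X) where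
  isProbabilityMeasure c := by
    induction c using Quotient.inductionOn with
    | _ P => exact inferInstanceAs (IsProbabilityMeasure P.walkMeasure)

/-! ### Stationary ergodic distributions and empirical distributional distance -/

/-- The distribution `μ_→` on `𝒢_→`: the rooted network `(G, o)` has distribution `μ` and, given
`(G, o)`, the walk is the simple random walk on `G` started at `o`. -/
noncomputable def withWalk [Finite X] (μ : Measure (RootedClass directed M X)) :
    Measure (WalkClass directed M X) :=
  μ.bind (walkKernel directed M X)

/-- `μ` is stationary and ergodic: `μ_→` is invariant and ergodic under the shift. -/
def IsStationaryErgodic [Finite X] (μ : Measure (RootedClass directed M X)) : Prop :=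
  Ergodic WalkClass.shift (withWalk μ)

namespace WalkClass

open Classical in
/-- `ν_N(F_c)`: the fraction of the first `N` vertices `O` of the walk with `(G, O) ∈ F_c`. -/
noncomputable def frequency (x : WalkClass directed M X) (N : ℕ) (c : RootedClass directed M X) :
    ℝ :=
  (1 / N : ℝ) * ∑ i ∈ Finset.range N, if x.rootAt i ∈ c.cylinder then 1 else 0

open Classical in
/-- The estimate of `μ(F_c)` from the first `N` vertices of the walk and their
`R`-neighbourhoods: the frequency of `F_c` if `c` has radius at most `R`, and `0` otherwise. -/
noncomputable def estimate (x : WalkClass directed M X) (N R : ℕ) (c : RootedClass directed M X) :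
    ℝ :=
  if c.radius ≤ R then x.frequency N c else 0

/-- The empirical distributional distance `d(S_N(G, o), μ)`, where the sample `S_N(G, o)` consists
of the `k N`-neighbourhoods of the first `N` vertices of the walk, `c i` is an enumeration of
the finite rooted networks, and `w i` is the weight of `F_{c i}`. -/
noncomputable def empiricalDist (w : ℕ → ℝ) (c : ℕ → RootedClass directed M X) (k : ℕ → ℕ)
    (N : ℕ) (x : WalkClass directed M X) (μ : Measure (RootedClass directed M X)) : ℝ :=
  ∑' i, w i * |x.estimate N (k N) (c i) - μ.real (c i).cylinder|

end WalkClass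

end RandomNetwork

/-!
The frequency with which the network seen from the walk lies in `F_c` is the Birkhoff average,
under the shift of `𝒢_→`, of the indicator of the event `(G, O₁) ∈ F_c`. The walk starts at the root
(`map_rootAt_zero_withWalk`), so this event has probability `μ(F_c)`, and by the pointwise ergodic
theorem for the ergodic measure `μ_→` the frequencies converge to `μ(F_c)` almost surely. If `c` has
finite radius, its estimate is the frequency once `k n` is at least this radius; if `c` has infinite
radius, then `F_c` is empty and the estimate is always `0`. So almost surely all the countably many
estimates converge (`ae_tendsto_estimate`), and since the errors are at most `1` and the weights
summable, dominated convergence gives the convergence of the weighted sum.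

The pointwise ergodic theorem (`ae_tendsto_birkhoffAverage`) is proved from a maximal inequality: if
`T` is ergodic and `∫ f < 0`, then almost surely the Birkhoff sums of `f` are bounded above
(`ae_bddAbove_maxBirkhoffSum`). Applied to `f - ∫ f - ε` and `∫ f - f - ε` for a sequence of `ε`
tending to `0`, it bounds the averages of `f` from both sides.
-/

namespace RandomNetwork

/-! ### The pointwise ergodic theorem -/

section PointwiseErgodic

variable {α : Type*} {T : α → α} {f : α → ℝ}

/-- The maximum of `0` and the Birkhoff sums `∑_{i < m} f (T^i x)` with `m ≤ n`, given by the
recursion that it satisfies. -/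
def maxBirkhoffSum (T : α → α) (f : α → ℝ) : ℕ → α → ℝ
  | 0, _ => 0
  | n + 1, x => max 0 (f x + maxBirkhoffSum T f n (T x))

lemma maxBirkhoffSum_nonneg (n : ℕ) (x : α) : 0 ≤ maxBirkhoffSum T f n x := by
  cases n with
  | zero => exact le_rfl
  | succ n => exact le_max_left _ _

lemma birkhoffSum_le_maxBirkhoffSum (n : ℕ) (x : α) :
    birkhoffSum T f n x ≤ maxBirkhoffSum T f n x := by
  induction n generalizing x with
  | zero => simp [maxBirkhoffSum]
  | succ n ih =>
    rw [birkhoffSum_succ']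
    exact le_max_of_le_right (by linarith [ih (T x)])

lemma maxBirkhoffSum_le_succ (n : ℕ) (x : α) :
    maxBirkhoffSum T f n x ≤ maxBirkhoffSum T f (n + 1) x := by
  induction n generalizing x with
  | zero => exact maxBirkhoffSum_nonneg _ _
  | succ n ih => exact max_le_max le_rfl (by linarith [ih (T x)])

/-- The set on which the partial maxima are bounded is invariant. -/
lemma bddAbove_maxBirkhoffSum_apply (x : α) :
    BddAbove (Set.range fun n => maxBirkhoffSum T f n (T x)) ↔
      BddAbove (Set.range fun n => maxBirkhoffSum T f n x) := by
  simp only [BddAbove, Set.Nonempty, upperBounds, Set.forall_mem_range, Set.mem_ofPred_eq]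
  constructor
  · rintro ⟨C, hC⟩
    refine ⟨max 0 (f x + C), fun n => ?_⟩
    cases n with
    | zero => exact le_max_left _ _
    | succ n => exact max_le_max le_rfl (by linarith [hC n])
  · rintro ⟨C, hC⟩
    refine ⟨C - f x, fun n => ?_⟩
    linarith [(le_max_right _ _).trans (hC (n + 1))]

variable [MeasurableSpace α] {μ : Measure α}

lemma integrable_maxBirkhoffSum (hT : MeasurePreserving T μ μ) (hf : Integrable f μ) (n : ℕ) :
    Integrable (maxBirkhoffSum T f n) μ := by
  induction n with
  | zero => exact integrable_zero _ _ _
  | succ n ih => exact (integrable_zero _ _ _).sup (hf.add (hT.integrable_comp_of_integrable ih))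

/-- The maximal inequality in its ergodic form. If the partial maxima `m n` were unbounded on a set
of positive measure, then by ergodicity almost everywhere. But then
`m (n + 1) - m n ∘ T = max (-m n ∘ T) f` tends to `f`, so `∫ f` would be the limit of the
nonnegative numbers `∫ (m (n + 1) - m n)`. -/
lemma ae_bddAbove_maxBirkhoffSum (hT : Ergodic T μ) (hf : Integrable f μ)
    (hneg : ∫ x, f x ∂μ < 0) :
    ∀ᵐ x ∂μ, BddAbove (Set.range fun n => maxBirkhoffSum T f n x) := by
  set m := maxBirkhoffSum T f
  have hm : ∀ n, Integrable (m n) μ := integrable_maxBirkhoffSum hT.toMeasurePreserving hf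
  have hmT : ∀ n, Integrable (m n ∘ T) μ := fun n =>
    hT.toMeasurePreserving.integrable_comp_of_integrable (hm n)
  let A : Set α := {x | BddAbove (Set.range fun n => m n x)}
  have hA : NullMeasurableSet A μ := by
    have : A = ⋃ C : ℕ, ⋂ n, {x | m n x ≤ C} := by
      ext x
      simp only [A, Set.mem_ofPred_eq, Set.mem_iUnion, Set.mem_iInter, BddAbove, Set.Nonempty,
        upperBounds, Set.forall_mem_range]
      constructor
      · rintro ⟨C, hC⟩
        obtain ⟨N, hN⟩ := exists_nat_ge C
        exact ⟨N, fun n => (hC n).trans hN⟩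
      · rintro ⟨C, hC⟩
        exact ⟨C, hC⟩
    rw [this]
    exact .iUnion fun C => .iInter fun n =>
      nullMeasurableSet_le (hm n).aemeasurable aemeasurable_const
  have hTA : T ⁻¹' A = A := Set.ext fun x => bddAbove_maxBirkhoffSum_apply x
  rcases hT.quasiErgodic.ae_empty_or_univ₀ hA hTA.eventuallyEq with h | h
  · exfalso
    have hlim : Tendsto (fun n => ∫ x, (m (n + 1) x - m n (T x)) ∂μ) atTop (𝓝 (∫ x, f x ∂μ)) := by
      have hmax : ∀ n x, m (n + 1) x - m n (T x) = max (-m n (T x)) (f x) := fun n x => by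
        change max 0 (f x + m n (T x)) - m n (T x) = _
        rw [← max_sub_sub_right, zero_sub, add_sub_cancel_right]
      refine tendsto_integral_of_dominated_convergence (fun x => |f x|)
        (fun n => ((hm (n + 1)).sub (hmT n)).aestronglyMeasurable) hf.abs ?_ ?_
      · refine fun n => ae_of_all _ fun x => ?_
        rw [hmax, Real.norm_eq_abs, abs_le]
        exact ⟨(neg_abs_le _).trans (le_max_right _ _), max_le
          ((neg_nonpos.2 (maxBirkhoffSum_nonneg n (T x))).trans (abs_nonneg _)) (le_abs_self _)⟩
      · filter_upwards [h] with x hx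
        have hx' : ¬ BddAbove (Set.range fun n => m n (T x)) := by
          rw [bddAbove_maxBirkhoffSum_apply]
          exact fun hb => (hx.mp hb).elim
        obtain ⟨N, hN⟩ : ∃ N, -f x ≤ m N (T x) := by
          by_contra! hlt
          exact hx' ⟨-f x, by rintro _ ⟨n, rfl⟩; exact (hlt n).le⟩
        refine tendsto_const_nhds.congr' ?_
        filter_upwards [eventually_ge_atTop N] with n hn
        have := hN.trans (monotone_nat_of_le_succ
          (fun n => maxBirkhoffSum_le_succ (T := T) (f := f) n (T x)) hn)
        rw [hmax, max_eq_right (by linarith)]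
    refine hneg.not_ge (ge_of_tendsto' hlim fun n => ?_)
    have hint : ∫ x, m n (T x) ∂μ = ∫ x, m n x ∂μ := by
      have hmn : AEStronglyMeasurable (m n) (μ.map T) := by
        rw [hT.map_eq]
        exact (hm n).aestronglyMeasurable
      rw [← integral_map hT.measurable.aemeasurable hmn, hT.map_eq]
    have hsub : ∫ x, (m (n + 1) x - m n (T x)) ∂μ = ∫ x, m (n + 1) x ∂μ - ∫ x, m n x ∂μ := by
      rw [← hint]
      exact integral_sub (hm (n + 1)) (hmT n)
    rw [hsub, sub_nonneg]
    exact integral_mono (hm n) (hm (n + 1)) fun x => maxBirkhoffSum_le_succ n x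
  · filter_upwards [h] with x hx
    exact hx.mpr trivial

/-- Subtracting `∫ f + ε` from `f` makes the integral negative, so the Birkhoff sums exceed
`n * (∫ f + ε)` by a bounded amount only. -/
lemma ae_exists_birkhoffSum_le [IsProbabilityMeasure μ] (hT : Ergodic T μ) (hf : Integrable f μ)
    {ε : ℝ} (hε : 0 < ε) :
    ∀ᵐ x ∂μ, ∃ C, ∀ n : ℕ, birkhoffSum T f n x ≤ n * (∫ y, f y ∂μ + ε) + C := by
  set a := ∫ y, f y ∂μ + ε
  have h := ae_bddAbove_maxBirkhoffSum hT (hf.sub (integrable_const a)) <| by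
    rw [integral_sub' hf (integrable_const a)]
    simp [a, hε]
  filter_upwards [h] with x ⟨C, hC⟩
  refine ⟨C, fun n => ?_⟩
  have := (birkhoffSum_le_maxBirkhoffSum n x).trans (hC ⟨n, rfl⟩)
  simp only [birkhoffSum, Pi.sub_apply, Finset.sum_sub_distrib, Finset.sum_const,
    Finset.card_range, nsmul_eq_mul] at this ⊢
  linarith

/-- Birkhoff's pointwise ergodic theorem for an ergodic transformation. -/
theorem ae_tendsto_birkhoffAverage [IsProbabilityMeasure μ] (hT : Ergodic T μ)
    (hf : Integrable f μ) :
    ∀ᵐ x ∂μ, Tendsto (fun n => birkhoffAverage ℝ T f n x) atTop (𝓝 (∫ y, f y ∂μ)) := by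
  have hpos : ∀ j : ℕ, (0 : ℝ) < 1 / (j + 1) := fun j => by positivity
  have h₁ := ae_all_iff.2 fun j => ae_exists_birkhoffSum_le hT hf (hpos j)
  have h₂ := ae_all_iff.2 fun j => ae_exists_birkhoffSum_le hT hf.neg (hpos j)
  filter_upwards [h₁, h₂] with x hx₁ hx₂
  refine Metric.tendsto_atTop'.2 fun ε hε => ?_
  obtain ⟨j, hj⟩ := exists_nat_one_div_lt (half_pos hε)
  obtain ⟨C₁, hC₁⟩ := hx₁ j
  obtain ⟨C₂, hC₂⟩ := hx₂ j
  obtain ⟨N, hN⟩ := exists_nat_ge (max C₁ C₂ / (ε / 2))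
  refine ⟨N, fun n hn => ?_⟩
  have hn' : (N : ℝ) < n := by exact_mod_cast hn
  have hn0 : (0 : ℝ) < n := (Nat.cast_nonneg N).trans_lt hn'
  have hC : max C₁ C₂ ≤ n * (ε / 2) := ((div_le_iff₀ (half_pos hε)).1 hN).trans (by gcongr)
  have hlt : n * (1 / ((j : ℝ) + 1)) < n * (ε / 2) := by gcongr
  have e₁ := hC₁ n
  have e₂ := hC₂ n
  simp only [birkhoffSum_neg, Pi.neg_apply, integral_neg] at e₂
  rw [Real.dist_eq, birkhoffAverage, smul_eq_mul, inv_mul_eq_div, abs_lt, lt_sub_iff_add_lt,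
    sub_lt_iff_lt_add, lt_div_iff₀ hn0, div_lt_iff₀ hn0]
  constructor
  · linarith [le_max_right C₁ C₂]
  · linarith [le_max_left C₁ C₂]

end PointwiseErgodic

/-! ### Empirical frequencies of the network seen from the walk -/

namespace PointedClass

variable {directed : Prop} {M : ℕ} {X : Type u} {ι κ : Type*}

lemma measurable_reindex [Finite X] [Finite ι] [Finite κ] (f : κ → ι) :
    Measurable (reindex f : PointedClass directed M X ι → PointedClass directed M X κ) := by
  refine measurable_generateFrom ?_
  rintro _ ⟨c, _, rfl⟩
  have : reindex f ⁻¹' c.cylinder = ⋃ r, {d : PointedClass directed M X ι |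
      d.ball r ∈ {e : PointedClass directed M X ι | (e.reindex f).ball r = c}} := by
    ext d
    simp [cylinder, ball_reindex_ball]
  rw [this]
  exact .iUnion fun r => measurableSet_ball_mem r _

end PointedClass

variable {directed : Prop} {M : ℕ} {X : Type u}

/-- A ball of radius `r` has radius at most `r`, so `F_c` is empty if `c` has vertices that cannot
be reached from the root. -/
lemma RootedClass.cylinder_eq_empty {c : RootedClass directed M X} (hc : c.radius = ⊤) :
    c.cylinder = ∅ := by
  refine Set.eq_empty_of_forall_notMem ?_
  rintro d ⟨r, rfl⟩
  refine (ENat.natCast_lt_top r).not_ge (hc.symm.le.trans ?_)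
  clear hc
  induction d using Quotient.inductionOn with
  | _ P =>
    refine iSup_le fun v => (Network.edist_le_iff _ _ _ _).2 ?_
    obtain ⟨i, n, hn, h⟩ := Pointed.mem_ballSet.1 v.2
    exact ⟨n, hn, Pointed.reachIn_induce h hn
      (fun m hm z hz => Pointed.mem_ballSet.2 ⟨i, m, hm, hz⟩) (P.pt_mem_ballSet r i) v.2⟩

namespace WalkClass

lemma rootAt_shift (n : ℕ) (x : WalkClass directed M X) :
    x.shift.rootAt n = x.rootAt (n + 1) :=
  PointedClass.reindex_reindex _ _ _

lemma rootAt_zero_iterate_shift (n : ℕ) (x : WalkClass directed M X) :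
    (shift^[n] x).rootAt 0 = x.rootAt n := by
  suffices h : ∀ m, (shift^[n] x).rootAt m = x.rootAt (m + n) by simpa using h 0
  induction n generalizing x with
  | zero => exact fun m => rfl
  | succ n ih =>
    intro m
    rw [Function.iterate_succ_apply, ih, rootAt_shift, add_assoc]

lemma measurable_rootAt_zero [Finite X] :
    Measurable (rootAt 0 : WalkClass directed M X → RootedClass directed M X) := by
  have : (rootAt 0 : WalkClass directed M X → RootedClass directed M X) =
      PointedClass.reindex (fun _ => 0) ∘ initial 0 := by
    funext x
    exact (PointedClass.reindex_reindex x.1 (fun i : Fin 1 => (i : ℕ)) (fun _ => 0)).symm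
  rw [this]
  exact (PointedClass.measurable_reindex _).comp (measurable_initial 0)

lemma frequency_eq_birkhoffAverage (x : WalkClass directed M X) (N : ℕ)
    (c : RootedClass directed M X) :
    x.frequency N c =
      birkhoffAverage ℝ shift ((rootAt 0 ⁻¹' c.cylinder).indicator fun _ => 1) N x := by
  classical
  rw [frequency, birkhoffAverage, birkhoffSum, smul_eq_mul, one_div]
  congr 1
  refine Finset.sum_congr rfl fun i _ => ?_
  rw [Set.indicator_apply, Set.mem_preimage, rootAt_zero_iterate_shift]

lemma frequency_mem_Icc (x : WalkClass directed M X) (N : ℕ) (c : RootedClass directed M X) :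
    x.frequency N c ∈ Set.Icc 0 1 := by
  classical
  rw [frequency, one_div, inv_mul_eq_div]
  constructor
  · exact div_nonneg (Finset.sum_nonneg fun i _ => by split_ifs <;> simp) (Nat.cast_nonneg N)
  · refine div_le_one_of_le₀ ?_ (Nat.cast_nonneg N)
    simpa using Finset.card_filter_le (Finset.range N) (fun i => x.rootAt i ∈ c.cylinder)

lemma estimate_mem_Icc (x : WalkClass directed M X) (N R : ℕ) (c : RootedClass directed M X) :
    x.estimate N R c ∈ Set.Icc 0 1 := by
  unfold estimate
  split_ifs
  · exact x.frequency_mem_Icc N c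
  · simp

end WalkClass

/-- Given the network `(G, o)`, the walk starts at `o` almost surely. -/
lemma walkKernel_rootAt_zero [Finite X] (d : RootedClass directed M X)
    {A : Set (RootedClass directed M X)} (hA : MeasurableSet A) :
    walkKernel directed M X d (WalkClass.rootAt 0 ⁻¹' A) = A.indicator 1 d := by
  induction d using Quotient.inductionOn with
  | _ P =>
    have hstart : ∀ᵐ w ∂P.net.walkLaw (P.pt ()), w 0 = P.pt () := by
      refine (mem_ae_iff_prob_eq_one (MeasurableSet.of_discrete.preimage
        (measurable_pi_apply 0) : MeasurableSet ((fun w : ℕ → P.net.V => w 0) ⁻¹' {P.pt ()}))).2 ?_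
      convert P.net.walkLaw_cylinder (P.pt ()) 0 (fun _ => P.pt ()) using 2
      · ext w
        simp
      · simp [Network.pathProb]
    change P.walkMeasure _ = _
    rw [P.walkMeasure_apply (WalkClass.measurable_rootAt_zero hA)
      (B := {w | PointedClass.mk ⟨P.net, fun _ => w 0⟩ ∈ A}) fun _ => Iff.rfl]
    have hB : {w : ℕ → P.net.V | PointedClass.mk ⟨P.net, fun _ : Unit => w 0⟩ ∈ A}
        =ᵐ[P.net.walkLaw (P.pt ())] {_w | PointedClass.mk P ∈ A} := by
      filter_upwards [hstart] with w hw
      change (PointedClass.mk ⟨P.net, fun _ => w 0⟩ ∈ A) = _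
      rw [hw]
      rfl
    rw [measure_congr hB]
    by_cases h : PointedClass.mk P ∈ A
    · exact (by simp [h] : P.net.walkLaw (P.pt ()) {_w | PointedClass.mk P ∈ A} = 1).trans
        (Set.indicator_of_mem h (1 : RootedClass directed M X → ℝ≥0∞)).symm
    · exact (by simp [h] : P.net.walkLaw (P.pt ()) {_w | PointedClass.mk P ∈ A} = 0).trans
        (Set.indicator_of_notMem h (1 : RootedClass directed M X → ℝ≥0∞)).symm

instance [Finite X] (μ : Measure (RootedClass directed M X)) [IsProbabilityMeasure μ] :
    IsProbabilityMeasure (withWalk μ) := by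
  unfold withWalk
  infer_instance

lemma map_rootAt_zero_withWalk [Finite X] (μ : Measure (RootedClass directed M X)) :
    (withWalk μ).map (WalkClass.rootAt 0) = μ := by
  ext A hA
  rw [Measure.map_apply WalkClass.measurable_rootAt_zero hA, withWalk,
    Measure.bind_apply (WalkClass.measurable_rootAt_zero hA) (Kernel.aemeasurable _)]
  simp_rw [walkKernel_rootAt_zero _ hA]
  exact lintegral_indicator_one hA

/-- The estimates of the probability of a single `F_c` are consistent. -/
lemma ae_tendsto_estimate [Finite X] {μ : Measure (RootedClass directed M X)}
    [IsProbabilityMeasure μ] (hμ : IsStationaryErgodic μ) {k : ℕ → ℕ} (hk : Tendsto k atTop atTop)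
    {c : RootedClass directed M X} (hc : c.IsFinite) :
    ∀ᵐ x ∂withWalk μ,
      Tendsto (fun n => x.estimate n (k n) c) atTop (𝓝 (μ.real c.cylinder)) := by
  have hcm := PointedClass.measurableSet_cylinder hc
  have hm : MeasurableSet (WalkClass.rootAt 0 ⁻¹' c.cylinder) :=
    WalkClass.measurable_rootAt_zero hcm
  by_cases hr : c.radius = ⊤
  -- Here the estimate is `0` for every `n`, which is the correct value because `F_c` is empty.
  · refine ae_of_all _ fun x => ?_
    simp [WalkClass.estimate, hr, RootedClass.cylinder_eq_empty hr]
  · obtain ⟨r, hr⟩ := ENat.ne_top_iff_exists.1 hr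
    filter_upwards [ae_tendsto_birkhoffAverage hμ
      ((integrable_const (1 : ℝ)).indicator hm)] with x hx
    rw [integral_indicator_const _ hm, smul_eq_mul, mul_one,
      ← map_measureReal_apply WalkClass.measurable_rootAt_zero hcm,
      map_rootAt_zero_withWalk] at hx
    refine hx.congr' ?_
    filter_upwards [hk.eventually_ge_atTop r] with n hn
    rw [WalkClass.estimate, if_pos (hr ▸ by exact_mod_cast hn),
      WalkClass.frequency_eq_birkhoffAverage]

end RandomNetwork

theorem mainTheorem5 (directed : Prop) (M : ℕ) (X : Type u) [Finite X]
    (w : ℕ → ℝ) (hw_pos : ∀ i, 0 < w i) (hw : Summable w)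
    (c : ℕ → RandomNetwork.RootedClass directed M X) (hc_fin : ∀ i, (c i).IsFinite)
    (hc : Set.range (fun i => (c i).cylinder) =
      {A | ∃ d : RandomNetwork.RootedClass directed M X, d.IsFinite ∧ A = d.cylinder})
    (k : ℕ → ℕ) (hk_mono : Monotone k) (hk : Tendsto k atTop atTop)
    (μ : Measure (RandomNetwork.RootedClass directed M X)) [IsProbabilityMeasure μ]
    (hμ : RandomNetwork.IsStationaryErgodic μ) :
    ∀ᵐ x ∂(RandomNetwork.withWalk μ),
      Tendsto (fun n => RandomNetwork.WalkClass.empiricalDist w c k n x μ) atTop (𝓝 0) := by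
  filter_upwards [ae_all_iff.2 fun i => RandomNetwork.ae_tendsto_estimate hμ hk (hc_fin i)]
    with x hx
  unfold RandomNetwork.WalkClass.empiricalDist
  -- The weights themselves dominate the series, as each estimation error is at most `1`.
  have h := tendsto_tsum_of_dominated_convergence (𝓕 := atTop)
    (f := fun n i => w i * |x.estimate n (k n) (c i) - μ.real (c i).cylinder|)
    (g := fun _ => 0) hw (fun i => ?_) (.of_forall fun n i => ?_)
  · simpa using h
  · simpa using ((hx i).sub_const (μ.real (c i).cylinder)).abs.const_mul (w i)
  · have h₁ := x.estimate_mem_Icc n (k n) (c i)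
    have h₂ : μ.real (c i).cylinder ∈ Set.Icc 0 1 := ⟨measureReal_nonneg, measureReal_le_one⟩
    rw [Real.norm_eq_abs, abs_mul, abs_abs, abs_of_pos (hw_pos i)]
    refine mul_le_of_le_one_right (hw_pos i).le (abs_le.2 ⟨?_, ?_⟩)
    · linarith [h₁.1, h₂.2]
    · linarith [h₁.2, h₂.1]
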